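/- **Theorem 4.1 (Cohomological Rank).** Let $R$ be a commutative Noetherian ring of finite Krull dimension and let $M$ be a finitely generated $R$-module. Let $\operatorname{len}(M)$ be the ordinal length of $M$, that is, the foundation rank of the zero submodule in the well-founded poset of all submodules of $M$ ordered by reverse inclusion, where the foundation rank of a submodule $N$ is defined recursively by $\operatorname{h}(N)=\sup\{\operatorname{h}(N')+1 : N\subsetneq N'\subseteq M\}$ and $\operatorname{len}(M)=\operatorname{h}(0)$. For a prime ideal $\mathfrak p$ of $R$, let $\mu_M(\mathfrak p)$ be the (finite) length, as a module over the local ring $R_{\mathfrak p}$, of $H^0_{\mathfrak pR_{\mathfrak p}}(M_{\mathfrak p})$, the submodule of all elements of $M_{\mathfrak p}$ that are killed by some power of $\mathfrak pR_{\mathfrak p}$. Then $$ \operatorname{len}(M)=\bigoplus_{\mathfrak p\in\operatorname{Ass}(M)}\mu_M(\mathfrak p)\,\omega^{\dim(R/\mathfrak p)}, $$ where $\operatorname{Ass}(M)$ is the finite set of associated primes of $M$, $a\,\omega^n$ (for natural numbers $a$ and $n$) is the sum of $a$ copies of $\omega^n$ (in the usual notation $\omega^n\cdot a$), and $\bigoplus$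 is the shuffle (natural, Hessenberg) sum of ordinals, which adds the coefficients of equal powers of $\omega$ in the Cantor normal forms (the empty sum being $0$). -/

import Mathlib

open Ordinal

/-! ### The shuffle (natural, Hessenberg) sum of ordinals -/

/-- The Cantor coefficients of `a`: the exponent `e` is sent to the coefficient of `ω ^ e` in the
Cantor normal form of `a` in base `ω`. -/
noncomputable def cantorCoeff (a : Ordinal) : Ordinal →₀ ℕ :=
  (CNF.coeff ω a).mapRange (fun c => Cardinal.toNat c.card) (by simp)

/-- The ordinal whose Cantor coefficients are the given natural numbers. -/
noncomputable def ofCantorCoeff (f : Ordinal →₀ ℕ) : Ordinal :=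
  CNF.eval ω (f.mapRange (fun n : ℕ => (n : Ordinal)) (by simp))

theorem ofCantorCoeff_cantorCoeff (a : Ordinal) : ofCantorCoeff (cantorCoeff a) = a := by
  have h : (cantorCoeff a).mapRange (fun n : ℕ => (n : Ordinal)) (by simp) = CNF.coeff ω a := by
    ext e
    have hlt : CNF.coeff ω a e < ω := by
      by_cases he : e ∈ (CNF ω a).map Prod.fst
      · obtain ⟨⟨e', c⟩, hc, rfl⟩ := List.mem_map.1 he
        rw [CNF.coeff_of_mem_CNF hc]
        exact CNF.snd_lt one_lt_omega0 hc
      · rw [CNF.coeff_of_notMem_CNF he]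
        exact omega0_pos
    obtain ⟨n, hn⟩ := lt_omega0.1 hlt
    simp [cantorCoeff, hn]
  rw [ofCantorCoeff, h, CNF.eval_coeff]

theorem cantorCoeff_ofCantorCoeff (f : Ordinal →₀ ℕ) : cantorCoeff (ofCantorCoeff f) = f := by
  ext e
  rw [cantorCoeff, ofCantorCoeff, CNF.coeff_eval one_lt_omega0 (fun e => by simp)]
  simp

/-- The shuffle sum of a finite family of ordinals: Cantor coefficients are added. -/
noncomputable def shuffleSum {ι : Type*} (s : Finset ι) (a : ι → Ordinal) : Ordinal :=
  ofCantorCoeff (∑ i ∈ s, cantorCoeff (a i))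

/-! ### The ordinal length of a module -/

/-- The ordinal length of a Noetherian module: the foundation rank of the zero submodule, the
greatest element, in the well-founded poset of all submodules ordered by reverse inclusion. -/
noncomputable def ordinalLength (R M : Type*) [CommRing R] [AddCommGroup M] [Module R M]
    [IsNoetherian R M] : Ordinal :=
  IsWellFounded.rank (fun N' N : Submodule R M => N < N') ⊥

/-! ### Local multiplicities and the cohomological rank -/

/-- The zeroth local cohomology `H⁰_I(N) = Γ_I(N)`: the submodule of all elements of `N` that are
killed by some power of `I`. -/
def localCohomologyZero {A : Type*} [CommRing A] (I : Ideal A) (N : Type*) [AddCommGroup N]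
    [Module A N] : Submodule A N where
  carrier := {x | ∃ n : ℕ, ∀ a ∈ I ^ n, a • x = 0}
  zero_mem' := ⟨0, fun a _ => smul_zero a⟩
  add_mem' := by
    rintro x y ⟨m, hm⟩ ⟨n, hn⟩
    refine ⟨m + n, fun a ha => ?_⟩
    rw [smul_add, hm a (Ideal.pow_le_pow_right (Nat.le_add_right m n) ha),
      hn a (Ideal.pow_le_pow_right (Nat.le_add_left n m) ha), add_zero]
  smul_mem' := by
    rintro c x ⟨n, hn⟩
    exact ⟨n, fun a ha => by rw [smul_comm, hn a ha, smul_zero]⟩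

theorem length_localCohomologyZero_ne_top (A N : Type*) [CommRing A] [IsLocalRing A]
    [IsNoetherianRing A] [AddCommGroup N] [Module A N] [IsNoetherian A N] :
    Module.length A (localCohomologyZero (IsLocalRing.maximalIdeal A) N) ≠ ⊤ := by
  set m := IsLocalRing.maximalIdeal A
  set G := localCohomologyZero m N
  obtain ⟨s, hs⟩ := IsNoetherian.noetherian G
  have hsG : ∀ x ∈ s, ∃ n : ℕ, ∀ a ∈ m ^ n, a • x = 0 := fun x hx =>
    (hs ▸ Submodule.subset_span hx : x ∈ G)
  choose! f hf using hsG
  set n := s.sup f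
  have hkill : ∀ x ∈ G, ∀ a ∈ m ^ n, a • x = 0 := by
    intro x hx a ha
    rw [← hs] at hx
    induction hx using Submodule.span_induction with
    | mem x hx => exact hf x hx a (Ideal.pow_le_pow_right (Finset.le_sup hx) ha)
    | zero => simp
    | add x y _ _ h1 h2 => rw [smul_add, h1, h2, add_zero]
    | smul c x _ h => rw [smul_comm, h, smul_zero]
  have htor : Module.IsTorsionBySet A G (m ^ n : Ideal A) := fun x a =>
    Subtype.ext (hkill x x.2 a a.2)
  let _ := htor.module
  have : IsScalarTower A (A ⧸ m ^ n) G := htor.isScalarTower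
  have : IsArtinianRing (A ⧸ m ^ n) := by
    rw [isArtinianRing_iff_isNoetherianRing_krullDimLE_zero]
    refine ⟨inferInstance, Ring.krullDimLE_zero_iff.2 fun P hP => ?_⟩
    have hle : m ≤ P.comap (Ideal.Quotient.mk (m ^ n)) := by
      intro a ha
      refine Ideal.IsPrime.mem_of_pow_mem (hP.comap _) n ?_
      rw [Ideal.mem_comap, Ideal.Quotient.eq_zero_iff_mem.2 (Ideal.pow_mem_pow ha n)]
      exact zero_mem _
    have hmax : (P.comap (Ideal.Quotient.mk (m ^ n))).IsMaximal := by
      rw [← (IsLocalRing.maximalIdeal.isMaximal A).eq_of_le (hP.comap _).ne_top hle]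
      exact IsLocalRing.maximalIdeal.isMaximal A
    have h := Ideal.map_eq_top_or_isMaximal_of_surjective (Ideal.Quotient.mk (m ^ n))
      Ideal.Quotient.mk_surjective hmax
    rw [Ideal.map_comap_of_surjective _ Ideal.Quotient.mk_surjective P] at h
    exact h.resolve_left hP.ne_top
  have : Module.Finite (A ⧸ m ^ n) G := Module.Finite.of_restrictScalars_finite A (A ⧸ m ^ n) G
  rw [Module.length_eq_of_surjective (R := A ⧸ m ^ n) Ideal.Quotient.mk_surjective]
  exact Module.length_ne_top

/-- The zeroth local cohomology of the localization `M_p` with support in the maximal ideal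
`p R_p` of the local ring `R_p`. -/
abbrev localCohomologyZeroAt (R M : Type*) [CommRing R] [AddCommGroup M] [Module R M]
    (p : PrimeSpectrum R) :
    Submodule (Localization.AtPrime p.asIdeal) (LocalizedModule p.asIdeal.primeCompl M) :=
  localCohomologyZero (IsLocalRing.maximalIdeal (Localization.AtPrime p.asIdeal))
    (LocalizedModule p.asIdeal.primeCompl M)

/-- The local multiplicity `μ_M(p)`: the length of `H⁰` of `M_p` with support in `p R_p`. -/
noncomputable def localMultiplicity (R M : Type*) [CommRing R] [AddCommGroup M] [Module R M]
    (p : PrimeSpectrum R) : ℕ :=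
  (Module.length (Localization.AtPrime p.asIdeal) (localCohomologyZeroAt R M p)).toNat

/-- The length in the definition of `localMultiplicity` is finite for a finitely generated module
over a Noetherian ring. -/
theorem localMultiplicity_spec (R M : Type*) [CommRing R] [IsNoetherianRing R] [AddCommGroup M]
    [Module R M] [Module.Finite R M] (p : PrimeSpectrum R) :
    Module.length (Localization.AtPrime p.asIdeal) (localCohomologyZeroAt R M p) =
      (localMultiplicity R M p : ℕ∞) := by
  have : IsNoetherian (Localization.AtPrime p.asIdeal)
      (LocalizedModule p.asIdeal.primeCompl M) := isNoetherian_of_isNoetherianRing_of_finite _ _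
  exact (ENat.natCast_toNat (length_localCohomologyZero_ne_top _ _)).symm

/-- The dimension of `R / p` as a natural number. -/
noncomputable def quotientDim (R : Type*) [CommRing R] (p : PrimeSpectrum R) : ℕ :=
  ((ringKrullDim (R ⧸ p.asIdeal)).unbotD 0).toNat

theorem quotientDim_spec (R : Type*) [CommRing R] (hR : ringKrullDim R < ⊤)
    (p : PrimeSpectrum R) : ringKrullDim (R ⧸ p.asIdeal) = (quotientDim R p : WithBot ℕ∞) := by
  have h1 : ringKrullDim (R ⧸ p.asIdeal) < ⊤ := (ringKrullDim_quotient_le _).trans_lt hR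
  have h0 : 0 ≤ ringKrullDim (R ⧸ p.asIdeal) := ringKrullDim_nonneg_of_nontrivial
  unfold quotientDim
  revert h0 h1
  generalize ringKrullDim (R ⧸ p.asIdeal) = d
  intro h1 h0
  induction d with
  | bot => simp at h0
  | coe d =>
    have hd : d ≠ ⊤ := by rintro rfl; exact lt_irrefl _ h1
    exact congrArg _ (ENat.natCast_toNat hd).symm

/-- The finite set of associated primes of a finitely generated module. -/
noncomputable def assPrimes (R M : Type*) [CommRing R] [IsNoetherianRing R] [AddCommGroup M]
    [Module R M] [Module.Finite R M] : Finset (PrimeSpectrum R) :=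
  ((associatedPrimes.finite R M).preimage
    (fun _ _ _ _ h => PrimeSpectrum.ext h : Set.InjOn PrimeSpectrum.asIdeal _)).toFinset

theorem mem_assPrimes (R M : Type*) [CommRing R] [IsNoetherianRing R] [AddCommGroup M]
    [Module R M] [Module.Finite R M] (p : PrimeSpectrum R) :
    p ∈ assPrimes R M ↔ p.asIdeal ∈ associatedPrimes R M := by
  simp [assPrimes]

/-- The cohomological rank: the shuffle sum of the ordinals `μ_M(p) ω ^ dim (R / p)` (the
`μ_M(p)`-fold sum of `ω ^ dim (R / p)`) over the associated primes `p` of `M`. -/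
noncomputable def cohomologicalRank (R M : Type*) [CommRing R] [IsNoetherianRing R]
    [AddCommGroup M] [Module R M] [Module.Finite R M] : Ordinal :=
  shuffleSum (assPrimes R M)
    (fun p => ω ^ (quotientDim R p : Ordinal) * (localMultiplicity R M p : Ordinal))

/-!
For a quotient `M'` of `M`, the cohomological rank is determined by its Cantor coefficients
`c_d(M') = ∑ μ_{M'}(p)`, the sum running over the primes `p` with `dim R / p = d` (the local
multiplicity vanishes outside the associated primes), and ordinals are compared lexicographically
by their coefficients. The rank of a submodule `N` in the poset of submodules under reverse
inclusion is shown to be the cohomological rank of `M ⧸ N` by well-founded induction on `N`, so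
two facts about quotients are needed.

*Strict decrease* (`cohomologicalRank_quotient_lt`). It suffices to divide `M` by a nonzero
submodule `K` of a cyclic submodule `R x ≅ R / p`, since every inclusion of submodules begins with
such a step. Over `R_p` the localization of `K` is a residue field, so the multiplicity at `p`
drops by exactly one (`localMultiplicity_eq_one_add`), because zeroth local cohomology is exact when
the kernel is torsion. At any other prime `p'` with `dim R / p' ≥ dim R / p` the module `K`
localizes to zero, so the multiplicity is unchanged.

*Cofinality* (`exists_le_cohomologicalRank_of_lt`). Let `d` be the least exponent with
`c_d(M) ≠ 0`, attained at an associated prime `p`, the annihilator of `x`. If `d = 0`, dividing by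
the simple module `R x` lowers the rank by one. If `d > 0`, choose a prime `q` above `p` with
`dim R / q = d - 1` and divide by `q ^ k x`: the coefficient at `d` drops by one, those above `d`
are unchanged, and `R x / q ^ k x` contributes at least `k` to the coefficient at `d - 1` by
Nakayama's lemma (`le_localMultiplicity_of_ker_eq`). With `k` large this exceeds any given ordinal
below the rank of `M` (`le_ofCantorCoeff_of_lt`).
-/

/-! ### Comparing ordinals by their Cantor coefficients -/

theorem ofCantorCoeff_single (e : Ordinal) (n : ℕ) :
    ofCantorCoeff (Finsupp.single e n) = ω ^ e * (n : Ordinal) := by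
  rw [ofCantorCoeff, Finsupp.mapRange_single, CNF.eval_single]

theorem cantorCoeff_opow_mul_natCast (e : Ordinal) (n : ℕ) :
    cantorCoeff (ω ^ e * (n : Ordinal)) = Finsupp.single e n := by
  rw [← ofCantorCoeff_single, cantorCoeff_ofCantorCoeff]

/-- A Cantor normal form, cut at the exponent `e`. -/
theorem ofCantorCoeff_eq_add (f : Ordinal →₀ ℕ) (e : Ordinal) :
    ofCantorCoeff f = ofCantorCoeff (f.filter (e < ·)) +
      (ω ^ e * (f e : Ordinal) + ofCantorCoeff (f.filter (· < e))) := by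
  have h : f = f.filter (e < ·) + (Finsupp.single e (f e) + f.filter (· < e)) := by
    ext x
    rcases lt_trichotomy x e with hx | rfl | hx
    · simp [hx, hx.ne, hx.not_gt]
    · simp
    · simp [hx, hx.ne', hx.not_gt]
  have hmap (f g : Ordinal →₀ ℕ) : (f + g).mapRange (fun n : ℕ => (n : Ordinal)) (by simp) =
      f.mapRange (fun n : ℕ => (n : Ordinal)) (by simp) +
        g.mapRange (fun n : ℕ => (n : Ordinal)) (by simp) :=
    Finsupp.mapRange_add (by simp) f g
  conv_lhs => rw [h]
  unfold ofCantorCoeff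
  rw [hmap, hmap, Finsupp.mapRange_single, CNF.eval_add, CNF.eval_single_add']
  · intro x hx
    by_contra hn
    simp [hn] at hx
  · intro x hx y hy
    have hx' : e < x := by
      by_contra hn
      simp [hn] at hx
    refine le_trans ?_ hx'.le
    by_contra! hn
    simp [hn.ne', hn.not_gt] at hy

theorem ofCantorCoeff_filter_lt (f : Ordinal →₀ ℕ) (e : Ordinal) :
    ofCantorCoeff (f.filter (· < e)) < ω ^ e := by
  refine CNF.eval_lt (fun x => by simp) fun x hx => ?_
  by_contra hn
  simp [hn] at hx

/-- Ordinals are ordered lexicographically by their Cantor coefficients, larger exponents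
first. -/
theorem ofCantorCoeff_lt {f g : Ordinal →₀ ℕ} {e : Ordinal} (h : ∀ x, e < x → f x = g x)
    (he : f e < g e) : ofCantorCoeff f < ofCantorCoeff g := by
  have hfg : f.filter (e < ·) = g.filter (e < ·) := by
    ext x
    by_cases hx : e < x
    · simp [hx, h x hx]
    · simp [hx]
  rw [ofCantorCoeff_eq_add f e, ofCantorCoeff_eq_add g e, hfg]
  gcongr
  calc ω ^ e * (f e : Ordinal) + ofCantorCoeff (f.filter (· < e))
      < ω ^ e * (f e : Ordinal) + ω ^ e := by gcongr; exact ofCantorCoeff_filter_lt f e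
    _ = ω ^ e * ((f e + 1 : ℕ) : Ordinal) := by push_cast; rw [mul_add_one]
    _ ≤ ω ^ e * (g e : Ordinal) := by gcongr; exact he
    _ ≤ _ := le_self_add

/-- If two families of Cantor coefficients differ, there is a largest exponent where they do. -/
theorem exists_max_ne {f g : Ordinal →₀ ℕ} (h : f ≠ g) :
    ∃ e, f e ≠ g e ∧ ∀ x, e < x → f x = g x := by
  have hne : (f.neLocus g).Nonempty := Finsupp.nonempty_neLocus_iff.2 h
  refine ⟨(f.neLocus g).max' hne, Finsupp.mem_neLocus.1 (Finset.max'_mem _ hne), fun x hx => ?_⟩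
  by_contra hn
  exact (Finset.le_max' _ x (Finsupp.mem_neLocus.2 hn)).not_gt hx

theorem exists_lt_of_ofCantorCoeff_lt {f g : Ordinal →₀ ℕ}
    (h : ofCantorCoeff f < ofCantorCoeff g) :
    ∃ e, f e < g e ∧ ∀ x, e < x → f x = g x := by
  obtain ⟨e, he, hx⟩ := exists_max_ne (f := f) (g := g) (by rintro rfl; exact lt_irrefl _ h)
  refine ⟨e, he.lt_of_le ?_, hx⟩
  by_contra! hlt
  exact lt_asymm h (ofCantorCoeff_lt (fun x h' => (hx x h').symm) hlt)

/-- Let `d` be the least exponent in the Cantor normal form of `g`. An ordinal `a` below `g` is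
at most `f` as soon as `f` arises from `g` by lowering the coefficient at `d` by one and the
coefficient of `f` at `d - 1` exceeds that of `a`. -/
theorem le_ofCantorCoeff_of_lt {a f g : Ordinal →₀ ℕ} {d : ℕ}
    (ha : ofCantorCoeff a < ofCantorCoeff g)
    (hd : ∀ x < (d : Ordinal), g x = 0) (hgt : ∀ x > (d : Ordinal), f x = g x)
    (heq : f d + 1 = g d) (hlow : ∀ n : ℕ, n + 1 = d → a n < f n) :
    ofCantorCoeff a ≤ ofCantorCoeff f := by
  obtain ⟨e, he, hx⟩ := exists_lt_of_ofCantorCoeff_lt ha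
  have hde : (d : Ordinal) ≤ e := by
    by_contra! hlt
    simp [hd e hlt] at he
  rcases hde.lt_or_eq with hlt | rfl
  · exact (ofCantorCoeff_lt (fun x h => (hx x h).trans (hgt x (hlt.trans h)).symm)
      (by rwa [hgt e hlt])).le
  have hagree : ∀ x, (d : Ordinal) < x → a x = f x := fun x h => (hx x h).trans (hgt x h).symm
  rcases (show a d ≤ f d by lia).lt_or_eq with hlt | had
  · exact (ofCantorCoeff_lt hagree hlt).le
  rcases d with _ | n
  · refine le_of_eq (congrArg _ (Finsupp.ext fun x => ?_))
    rcases eq_or_ne x 0 with rfl | h0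
    · simpa using had
    · exact hagree x (by simpa [pos_iff_ne_zero] using h0)
  · refine (ofCantorCoeff_lt (e := (n : Ordinal)) (fun x h => ?_) (hlow n rfl)).le
    have h' : ((n + 1 : ℕ) : Ordinal) ≤ x := by
      push_cast
      exact Order.add_one_le_of_lt h
    rcases h'.lt_or_eq with h' | rfl
    · exact hagree x h'
    · exact had

/-! ### Zeroth local cohomology over a Noetherian ring -/

theorem exists_pow_smul_eq_zero_of_fg {A X : Type*} [CommRing A] [AddCommGroup X] [Module A X]
    (I : Ideal A) {N : Submodule A X} (hN : N.FG) (h : N ≤ localCohomologyZero I X) :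
    ∃ k : ℕ, ∀ x ∈ N, ∀ a ∈ I ^ k, a • x = 0 := by
  obtain ⟨s, rfl⟩ := hN
  have hs : ∀ x ∈ s, ∃ n : ℕ, ∀ a ∈ I ^ n, a • x = 0 := fun x hx => h (Submodule.subset_span hx)
  choose! n hn using hs
  refine ⟨s.sup n, fun x hx a ha => ?_⟩
  induction hx using Submodule.span_induction with
  | mem x hx => exact hn x hx a (Ideal.pow_le_pow_right (Finset.le_sup hx) ha)
  | zero => simp
  | add x y _ _ h1 h2 => rw [smul_add, h1, h2, add_zero]
  | smul c x _ h => rw [smul_comm, h, smul_zero]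

theorem localCohomologyZero_eq_comap {A X Y : Type*} [CommRing A] [AddCommGroup X] [Module A X]
    [IsNoetherian A X] [AddCommGroup Y] [Module A Y] (I : Ideal A) (f : X →ₗ[A] Y)
    (hker : LinearMap.ker f ≤ localCohomologyZero I X) :
    localCohomologyZero I X = (localCohomologyZero I Y).comap f := by
  refine le_antisymm ?_ ?_
  · rintro x ⟨n, hn⟩
    exact ⟨n, fun a ha => by rw [← map_smul, hn a ha, map_zero]⟩
  · rintro x ⟨n, hn⟩
    obtain ⟨k, hk⟩ := exists_pow_smul_eq_zero_of_fg I (IsNoetherian.noetherian _) hker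
    have hle : I ^ k * I ^ n ≤ LinearMap.ker (LinearMap.toSpanSingleton A X x) := by
      refine Ideal.mul_le.2 fun a ha b hb => ?_
      rw [LinearMap.mem_ker, LinearMap.toSpanSingleton_apply, mul_smul]
      exact hk _ (by rw [LinearMap.mem_ker, map_smul, hn b hb]) a ha
    refine ⟨k + n, fun a ha => ?_⟩
    rw [pow_add] at ha
    exact hle ha

/-- Zeroth local cohomology is exact on the right if the kernel is torsion, since then the first
local cohomology of the kernel vanishes. -/
theorem length_localCohomologyZero_eq_add {A X Y : Type*} [CommRing A] [AddCommGroup X]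
    [Module A X] [IsNoetherian A X] [AddCommGroup Y] [Module A Y] (I : Ideal A) (f : X →ₗ[A] Y)
    (hf : Function.Surjective f) (hker : LinearMap.ker f ≤ localCohomologyZero I X) :
    Module.length A (localCohomologyZero I X) =
      Module.length A (LinearMap.ker f) + Module.length A (localCohomologyZero I Y) := by
  have hcomap := localCohomologyZero_eq_comap I f hker
  refine Module.length_eq_add_of_exact (Submodule.inclusion hker)
    (f.restrict (p := localCohomologyZero I X) (q := localCohomologyZero I Y)
      fun x hx => by rwa [hcomap] at hx) (Submodule.inclusion_injective _) ?_ ?_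
  · rintro ⟨y, hy⟩
    obtain ⟨x, rfl⟩ := hf y
    exact ⟨⟨x, by rw [hcomap]; exact hy⟩, rfl⟩
  · rintro ⟨x, hx⟩
    constructor
    · intro h
      exact ⟨⟨x, congrArg Subtype.val h⟩, rfl⟩
    · rintro ⟨⟨z, hz⟩, h⟩
      obtain rfl : z = x := congrArg Subtype.val h
      exact Subtype.ext hz

/-- If the `k`-th power of the maximal ideal does not kill `X`, then the powers of the maximal
ideal give a chain of length `k + 1` in `X`, strict by Nakayama's lemma. -/
theorem le_length_of_pow_smul_top_ne_bot {A X : Type*} [CommRing A] [IsLocalRing A]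
    [AddCommGroup X] [Module A X] [IsNoetherian A X] {k : ℕ}
    (h : IsLocalRing.maximalIdeal A ^ k • (⊤ : Submodule A X) ≠ ⊥) :
    ((k + 1 : ℕ) : ℕ∞) ≤ Module.length A X := by
  set m := IsLocalRing.maximalIdeal A
  have hanti (i : ℕ) : m ^ (i + 1) • (⊤ : Submodule A X) ≤ m ^ i • ⊤ :=
    Submodule.smul_mono_left (Ideal.pow_le_pow_right i.le_succ)
  have hstrict (i : ℕ) (hi : i ≤ k) : m ^ (i + 1) • (⊤ : Submodule A X) < m ^ i • ⊤ := by
    refine (hanti i).lt_of_ne fun heq => h ?_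
    have hbot : m ^ i • (⊤ : Submodule A X) = ⊥ := by
      refine Submodule.eq_bot_of_le_smul_of_le_jacobson_bot m _ (IsNoetherian.noetherian _) ?_
        (IsLocalRing.maximalIdeal_le_jacobson ⊥)
      rw [← mul_smul, ← pow_succ', heq]
    rw [eq_bot_iff, ← hbot]
    exact Submodule.smul_mono_left (Ideal.pow_le_pow_right hi)
  let s : LTSeries (Submodule A X) :=
    { length := k + 1
      toFun := fun i => m ^ (k + 1 - i : ℕ) • ⊤
      step := fun i => by
        have hi : k + 1 - (i : ℕ) = (k - i) + 1 := by lia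
        have hi' : k + 1 - ((i : ℕ) + 1) = k - i := by lia
        simp only [Fin.val_castSucc, Fin.val_succ, hi, hi']
        exact hstrict _ (Nat.sub_le _ _) }
  have := Order.LTSeries.length_le_krullDim s
  rw [← Module.coe_length] at this
  exact_mod_cast this

theorem length_span_singleton_eq_one {A X : Type*} [CommRing A] [IsLocalRing A]
    [AddCommGroup X] [Module A X] {x : X} (hx : x ≠ 0)
    (h : ∀ a ∈ IsLocalRing.maximalIdeal A, a • x = 0) :
    Module.length A (Submodule.span A {x}) = 1 := by
  rw [Module.length_eq_one_iff, isSimpleModule_iff_isAtom]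
  refine ⟨by simpa using hx, fun N hN => ?_⟩
  by_contra hne
  obtain ⟨y, hy, hy0⟩ := N.ne_bot_iff.1 hne
  obtain ⟨a, rfl⟩ := Submodule.mem_span_singleton.1 (hN.le hy)
  have ha : IsUnit a := by
    by_contra hu
    exact hy0 (h a ((IsLocalRing.mem_maximalIdeal a).2 hu))
  refine hN.not_ge ((Submodule.span_singleton_le_iff_mem _ _).2 ?_)
  obtain ⟨u, rfl⟩ := ha
  simpa [smul_smul] using N.smul_mem (↑u⁻¹ : A) hy

/-! ### Dimensions of quotients by primes -/

theorem coe_quotientDim {R : Type*} [CommRing R] (hR : ringKrullDim R < ⊤)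
    (p : PrimeSpectrum R) : (quotientDim R p : ℕ∞) = Order.coheight p := by
  have h := quotientDim_spec R hR p
  rw [ringKrullDim_quotient] at h
  have h2 := Order.coheight_eq_krullDim_Ici p
  have h3 : PrimeSpectrum.zeroLocus (p.asIdeal : Set R) = Set.Ici p := by
    ext q
    exact Iff.rfl
  rw [h3, ← h2] at h
  exact_mod_cast h.symm

theorem quotientDim_lt_of_lt {R : Type*} [CommRing R] (hR : ringKrullDim R < ⊤)
    {p q : PrimeSpectrum R} (h : p < q) : quotientDim R q < quotientDim R p := by
  have hq := Order.coheight_strictAnti h (by rw [← coe_quotientDim hR]; exact ENat.natCast_lt_top _)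
  rw [← coe_quotientDim hR, ← coe_quotientDim hR] at hq
  exact_mod_cast hq

theorem exists_lt_quotientDim_eq {R : Type*} [CommRing R] (hR : ringKrullDim R < ⊤)
    {p : PrimeSpectrum R} {n : ℕ} (h : n + 1 = quotientDim R p) :
    ∃ q, p < q ∧ quotientDim R q = n := by
  have hp : Order.coheight p = n + 1 := by rw [← coe_quotientDim hR, ← h]; rfl
  obtain ⟨-, ⟨q, hq, hn⟩, -⟩ := Order.coheight_eq_coe_add_one_iff.1 hp
  rw [← coe_quotientDim hR] at hn
  exact ⟨q, hq, by exact_mod_cast hn⟩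

/-! ### Local multiplicities under surjections -/

section Localized

variable {R M M' : Type*} [CommRing R] [AddCommGroup M] [Module R M] [AddCommGroup M'] [Module R M']

theorem localizedModule_mk_eq_zero_iff {S : Submonoid R} {z : M} {s : S} :
    LocalizedModule.mk z s = 0 ↔ ∃ u ∈ S, u • z = 0 := by
  rw [← LocalizedModule.zero_mk 1, LocalizedModule.mk_eq]
  simp [Submonoid.smul_def]

theorem mk_mem_ker_localizedModule_map_iff {S : Submonoid R} {f : M →ₗ[R] M'} {z : M} {s : S} :
    LocalizedModule.mk z s ∈ LinearMap.ker (LocalizedModule.map S f) ↔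
      ∃ u ∈ S, u • z ∈ LinearMap.ker f := by
  have h : LocalizedModule.map S f (LocalizedModule.mk z s) = LocalizedModule.mk (f z) s :=
    IsLocalizedModule.map_LocalizedModules S f z s
  simp [LinearMap.mem_ker, h, localizedModule_mk_eq_zero_iff]

/-- A fraction `z / s` such that a multiple `u z` by an allowed denominator lies in `R c x`
is a multiple of the image of `c x`. -/
theorem exists_smul_mk_of_smul_eq {S : Submonoid R} {x z : M} {s : S} {u c : R} (hu : u ∈ S)
    (h : c • x = u • z) : ∃ b : Localization S,
      LocalizedModule.mk z s = b • algebraMap R (Localization S) c • LocalizedModule.mk x 1 := by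
  refine ⟨Localization.mk 1 (⟨u, hu⟩ * s), ?_⟩
  rw [algebraMap_smul, LocalizedModule.smul'_mk, LocalizedModule.mk_smul_mk, one_smul, mul_one, h]
  exact (LocalizedModule.mk_cancel_common_left (⟨u, hu⟩ : S) s z).symm

/-- A power `(p R_p) ^ n` is generated by the image of `p ^ n`. -/
theorem maximalIdeal_pow_smul_eq_zero {p : PrimeSpectrum R} {Y : Type*} [AddCommGroup Y]
    [Module (Localization.AtPrime p.asIdeal) Y] {y : Y} {n : ℕ}
    (h : ∀ a ∈ p.asIdeal ^ n, algebraMap R (Localization.AtPrime p.asIdeal) a • y = 0) :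
    ∀ b ∈ IsLocalRing.maximalIdeal (Localization.AtPrime p.asIdeal) ^ n, b • y = 0 := by
  intro b hb
  have hle : IsLocalRing.maximalIdeal (Localization.AtPrime p.asIdeal) ^ n ≤
      LinearMap.ker (LinearMap.toSpanSingleton (Localization.AtPrime p.asIdeal) Y y) := by
    rw [← Localization.AtPrime.map_eq_maximalIdeal, ← Ideal.map_pow, Ideal.map, Ideal.span_le]
    rintro _ ⟨a, ha, rfl⟩
    exact h a ha
  exact hle hb

theorem algebraMap_mem_maximalIdeal_pow {p : PrimeSpectrum R} {n : ℕ} {a : R}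
    (h : a ∈ p.asIdeal ^ n) : algebraMap R (Localization.AtPrime p.asIdeal) a ∈
      IsLocalRing.maximalIdeal (Localization.AtPrime p.asIdeal) ^ n := by
  rw [← Localization.AtPrime.map_eq_maximalIdeal, ← Ideal.map_pow]
  exact Ideal.mem_map_of_mem _ h

end Localized

section Multiplicity

variable {R M M' : Type*} [CommRing R] [IsNoetherianRing R]
  [AddCommGroup M] [Module R M] [Module.Finite R M]
  [AddCommGroup M'] [Module R M'] [Module.Finite R M']

theorem mem_assPrimes_of_localMultiplicity_ne_zero {p : PrimeSpectrum R}
    (h : localMultiplicity R M p ≠ 0) : p ∈ assPrimes R M := by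
  set A := Localization.AtPrime p.asIdeal
  have hnt : Nontrivial (localCohomologyZeroAt R M p) := by
    rw [← Module.length_pos_iff (R := A), localMultiplicity_spec]
    exact_mod_cast Nat.pos_of_ne_zero h
  obtain ⟨P, hP⟩ := associatedPrimes.nonempty A (localCohomologyZeroAt R M p)
  obtain ⟨hprime, x, hx⟩ := isAssociatedPrime_iff.1 hP
  obtain ⟨n, hn⟩ := x.2
  -- Some power of the maximal ideal kills `x`, so the maximal ideal is the annihilator of `x`.
  have hPm : P = IsLocalRing.maximalIdeal A := by
    refine (IsLocalRing.le_maximalIdeal hprime.ne_top).antisymm fun a ha => ?_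
    refine hprime.mem_of_pow_mem n ?_
    rw [hx, Submodule.mem_colon_singleton, Submodule.mem_bot]
    exact Subtype.ext (hn _ (Ideal.pow_mem_pow ha n))
  have hmem : P ∈ associatedPrimes A (LocalizedModule p.asIdeal.primeCompl M) :=
    associatedPrimes.subset_of_injective
      (Submodule.subtype_injective (localCohomologyZeroAt R M p)) hP
  rw [mem_assPrimes]
  have := Module.associatedPrimes.comap_mem_associatedPrimes_of_mem_associatedPrimes_of_isLocalizedModule_of_fg
    p.asIdeal.primeCompl (LocalizedModule.mkLinearMap p.asIdeal.primeCompl M) P hmem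
    (IsNoetherian.noetherian _)
  rwa [hPm, ← Ideal.under, Localization.AtPrime.under_maximalIdeal] at this

theorem localMultiplicity_eq_add {f : M →ₗ[R] M'} (hf : Function.Surjective f)
    {p : PrimeSpectrum R} {n : ℕ}
    (hlen : Module.length (Localization.AtPrime p.asIdeal)
      (LinearMap.ker (LocalizedModule.map p.asIdeal.primeCompl f)) = n)
    (hker : LinearMap.ker (LocalizedModule.map p.asIdeal.primeCompl f) ≤
      localCohomologyZeroAt R M p) :
    localMultiplicity R M p = n + localMultiplicity R M' p := by
  have hsurj : Function.Surjective (LocalizedModule.map p.asIdeal.primeCompl f) :=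
    IsLocalizedModule.map_surjective p.asIdeal.primeCompl
      (LocalizedModule.mkLinearMap p.asIdeal.primeCompl M)
      (LocalizedModule.mkLinearMap p.asIdeal.primeCompl M') f hf
  have : IsNoetherian (Localization.AtPrime p.asIdeal)
      (LocalizedModule p.asIdeal.primeCompl M) := isNoetherian_of_isNoetherianRing_of_finite _ _
  have h := length_localCohomologyZero_eq_add _ _ hsurj hker
  rw [hlen, localMultiplicity_spec, localMultiplicity_spec] at h
  exact_mod_cast h

theorem localMultiplicity_eq_of_ker_localized_eq_zero {f : M →ₗ[R] M'}
    (hf : Function.Surjective f) {p : PrimeSpectrum R}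
    (h : ∀ z ∈ LinearMap.ker f, ∃ u ∉ p.asIdeal, u • z = 0) :
    localMultiplicity R M' p = localMultiplicity R M p := by
  have hbot : LinearMap.ker (LocalizedModule.map p.asIdeal.primeCompl f) = ⊥ := by
    refine (Submodule.eq_bot_iff _).2 fun w hw => ?_
    induction w using LocalizedModule.induction_on with
    | _ z s =>
      obtain ⟨u, hu, huz⟩ := mk_mem_ker_localizedModule_map_iff.1 hw
      obtain ⟨v, hv, hvz⟩ := h _ huz
      exact localizedModule_mk_eq_zero_iff.2
        ⟨v * u, p.asIdeal.primeCompl.mul_mem hv hu, by rw [mul_smul, hvz]⟩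
  have := localMultiplicity_eq_add (n := 0) hf (p := p) (by rw [hbot]; simp) (by rw [hbot]; simp)
  simpa using this.symm

theorem localMultiplicity_eq_of_not_le {f : M →ₗ[R] M'} (hf : Function.Surjective f) {x : M}
    {p p' : PrimeSpectrum R} (hx : ∀ a : R, a • x = 0 ↔ a ∈ p.asIdeal)
    (hle : LinearMap.ker f ≤ Submodule.span R {x}) (hp' : ¬ p ≤ p') :
    localMultiplicity R M' p' = localMultiplicity R M p' := by
  obtain ⟨a, hap, hap'⟩ := SetLike.not_le_iff_exists.1 (show ¬ p.asIdeal ≤ p'.asIdeal from hp')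
  refine localMultiplicity_eq_of_ker_localized_eq_zero hf fun z hz => ⟨a, hap', ?_⟩
  obtain ⟨c, rfl⟩ := Submodule.mem_span_singleton.1 (hle hz)
  rw [smul_comm, (hx a).2 hap, smul_zero]

/-- The localization at `p` of a nonzero submodule of `R x ≅ R / p` is a residue field. -/
theorem localMultiplicity_eq_one_add {f : M →ₗ[R] M'} (hf : Function.Surjective f) {x : M}
    {p : PrimeSpectrum R} (hx : ∀ a : R, a • x = 0 ↔ a ∈ p.asIdeal)
    (hle : LinearMap.ker f ≤ Submodule.span R {x}) (hne : LinearMap.ker f ≠ ⊥) :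
    localMultiplicity R M p = 1 + localMultiplicity R M' p := by
  set A := Localization.AtPrime p.asIdeal
  set x' : LocalizedModule p.asIdeal.primeCompl M := LocalizedModule.mk x 1
  have hx' : x' ≠ 0 := fun h => by
    obtain ⟨u, hu, hux⟩ := localizedModule_mk_eq_zero_iff.1 h
    exact hu ((hx u).1 hux)
  have hkill : ∀ b ∈ IsLocalRing.maximalIdeal A ^ 1, b • x' = 0 := by
    refine maximalIdeal_pow_smul_eq_zero fun a ha => ?_
    rw [pow_one] at ha
    rw [algebraMap_smul, LocalizedModule.smul'_mk, (hx a).2 ha, LocalizedModule.zero_mk]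
  have hspan : LinearMap.ker (LocalizedModule.map p.asIdeal.primeCompl f) =
      Submodule.span A {x'} := by
    refine le_antisymm (fun w hw => ?_) ?_
    · induction w using LocalizedModule.induction_on with
      | _ z s =>
        obtain ⟨u, hu, huz⟩ := mk_mem_ker_localizedModule_map_iff.1 hw
        obtain ⟨c, hc⟩ := Submodule.mem_span_singleton.1 (hle huz)
        obtain ⟨b, hb⟩ := exists_smul_mk_of_smul_eq (s := s) hu hc
        rw [hb, smul_smul]
        exact Submodule.smul_mem _ _ (Submodule.mem_span_singleton_self _)
    · rw [Submodule.span_singleton_le_iff_mem]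
      obtain ⟨z, hz, hz0⟩ := (Submodule.ne_bot_iff _).1 hne
      obtain ⟨c, rfl⟩ := Submodule.mem_span_singleton.1 (hle hz)
      exact mk_mem_ker_localizedModule_map_iff.2 ⟨c, fun hc => hz0 ((hx c).2 hc), hz⟩
  refine localMultiplicity_eq_add hf ?_ ?_
  · rw [hspan, length_span_singleton_eq_one hx' (by simpa using hkill)]
    rfl
  · rw [hspan, Submodule.span_singleton_le_iff_mem]
    exact ⟨1, hkill⟩

/-- If `R x ≅ R / p`, then passing to the quotient by `q ^ k x` for a prime `q` above `p` creates
multiplicity at least `k` at `q`. -/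
theorem le_localMultiplicity_of_ker_eq {f : M →ₗ[R] M'} {x : M}
    {p q : PrimeSpectrum R} (hx : ∀ a : R, a • x = 0 ↔ a ∈ p.asIdeal) (hpq : p < q) {k : ℕ}
    (hker : LinearMap.ker f = q.asIdeal ^ k • Submodule.span R {x}) :
    k ≤ localMultiplicity R M' q := by
  rcases k with _ | j
  · exact Nat.zero_le _
  set A := Localization.AtPrime q.asIdeal
  set m := IsLocalRing.maximalIdeal A
  set F := LocalizedModule.map q.asIdeal.primeCompl f
  set x' : LocalizedModule q.asIdeal.primeCompl M := LocalizedModule.mk x 1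
  have : IsNoetherian A (LocalizedModule q.asIdeal.primeCompl M) :=
    isNoetherian_of_isNoetherianRing_of_finite _ _
  have : IsNoetherian A (LocalizedModule q.asIdeal.primeCompl M') :=
    isNoetherian_of_isNoetherianRing_of_finite _ _
  have hkerF : LinearMap.ker F ≤ m ^ (j + 1) • Submodule.span A {x'} := by
    intro w hw
    induction w using LocalizedModule.induction_on with
    | _ z s =>
      obtain ⟨u, hu, huz⟩ := mk_mem_ker_localizedModule_map_iff.1 hw
      rw [hker] at huz
      obtain ⟨c, hc, hcz⟩ := Submodule.mem_smul_span_singleton.1 huz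
      obtain ⟨b, hb⟩ := exists_smul_mk_of_smul_eq (s := s) hu hcz
      rw [hb]
      exact Submodule.smul_mem _ _ (Submodule.smul_mem_smul (algebraMap_mem_maximalIdeal_pow hc)
        (Submodule.mem_span_singleton_self _))
  have hy : F x' ∈ localCohomologyZeroAt R M' q := by
    refine ⟨j + 1, maximalIdeal_pow_smul_eq_zero fun a ha => ?_⟩
    rw [← map_smul, algebraMap_smul, LocalizedModule.smul'_mk, ← LinearMap.mem_ker]
    refine mk_mem_ker_localizedModule_map_iff.2 ⟨1, one_mem _, ?_⟩
    rw [one_smul, hker]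
    exact Submodule.smul_mem_smul ha (Submodule.mem_span_singleton_self x)
  set W := Submodule.span A {F x'}
  have hW : W ≤ localCohomologyZeroAt R M' q := (Submodule.span_singleton_le_iff_mem _ _).2 hy
  have hpow : m ^ j • (⊤ : Submodule A W) ≠ ⊥ := by
    intro hbot
    have hkill : ∀ b ∈ m ^ j, b • x' ∈ LinearMap.ker F := by
      intro b hb
      have := (Submodule.eq_bot_iff _).1 hbot _ (Submodule.smul_mem_smul hb
        (Submodule.mem_top (x := (⟨F x', Submodule.mem_span_singleton_self _⟩ : W))))
      rw [LinearMap.mem_ker, map_smul]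
      exact congrArg Subtype.val this
    have hzero : m ^ j • Submodule.span A {x'} = ⊥ := by
      refine Submodule.eq_bot_of_le_smul_of_le_jacobson_bot m _ (IsNoetherian.noetherian _) ?_
        (IsLocalRing.maximalIdeal_le_jacobson ⊥)
      rw [← mul_smul, ← pow_succ']
      refine le_trans (fun w hw => ?_) hkerF
      obtain ⟨b, hb, rfl⟩ := Submodule.mem_smul_span_singleton.1 hw
      exact hkill b hb
    obtain ⟨t, htq, htp⟩ := SetLike.not_le_iff_exists.1 (show ¬ q.asIdeal ≤ p.asIdeal from hpq.not_ge)
    have ht := (Submodule.eq_bot_iff _).1 hzero _ (Submodule.smul_mem_smul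
      (algebraMap_mem_maximalIdeal_pow (Ideal.pow_mem_pow htq j))
      (Submodule.mem_span_singleton_self x'))
    rw [algebraMap_smul, LocalizedModule.smul'_mk] at ht
    obtain ⟨u, hu, hut⟩ := localizedModule_mk_eq_zero_iff.1 ht
    rw [smul_smul, hx] at hut
    rcases p.isPrime.mem_or_mem hut with h | h
    · exact hu (hpq.le h)
    · exact htp (p.isPrime.mem_of_pow_mem j h)
  have hlen := (le_length_of_pow_smul_top_ne_bot hpow).trans
    (Module.length_le_of_injective (Submodule.inclusion hW) (Submodule.inclusion_injective hW))
  rw [localMultiplicity_spec] at hlen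
  exact_mod_cast hlen

end Multiplicity

/-! ### The Cantor coefficients of the cohomological rank -/

/-- The Cantor coefficients of the cohomological rank: the coefficient at `d` is the sum of the
local multiplicities at the associated primes `p` with `dim R / p = d`. -/
noncomputable def multiplicityCoeff.{u, v} (R : Type u) (M : Type v) [CommRing R]
    [IsNoetherianRing R] [AddCommGroup M] [Module R M] [Module.Finite R M] : Ordinal.{v} →₀ ℕ :=
  ∑ p ∈ assPrimes R M, Finsupp.single (quotientDim R p : Ordinal) (localMultiplicity R M p)

theorem exists_smul_eq_zero_iff_of_mem_associatedPrimes {R M : Type*} [CommRing R]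
    [IsNoetherianRing R] [AddCommGroup M] [Module R M] {p : Ideal R}
    (h : p ∈ associatedPrimes R M) : ∃ x : M, ∀ a : R, a • x = 0 ↔ a ∈ p := by
  obtain ⟨-, x, hx⟩ := isAssociatedPrime_iff.1 h
  exact ⟨x, fun a => by rw [hx, Submodule.mem_colon_singleton, Submodule.mem_bot]⟩

section Coeff

universe v

variable {R : Type*} {M M' : Type v} [CommRing R] [IsNoetherianRing R]
  [AddCommGroup M] [Module R M] [Module.Finite R M]
  [AddCommGroup M'] [Module R M'] [Module.Finite R M']

theorem cohomologicalRank_eq_ofCantorCoeff :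
    cohomologicalRank R M = ofCantorCoeff (multiplicityCoeff R M) := by
  simp only [cohomologicalRank, shuffleSum, multiplicityCoeff, cantorCoeff_opow_mul_natCast]

/-- The sum defining the coefficients may run over any larger set of primes, since the local
multiplicity vanishes outside the associated primes. -/
theorem multiplicityCoeff_apply {S : Finset (PrimeSpectrum R)} (hS : assPrimes R M ⊆ S)
    (e : Ordinal) : multiplicityCoeff R M e =
      ∑ p ∈ S, if (quotientDim R p : Ordinal) = e then localMultiplicity R M p else 0 := by
  rw [multiplicityCoeff, Finsupp.finsetSum_apply]
  simp only [Finsupp.single_apply]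
  refine Finset.sum_subset hS fun p _ hp => ?_
  have : localMultiplicity R M p = 0 := by
    by_contra h
    exact hp (mem_assPrimes_of_localMultiplicity_ne_zero h)
  simp [this]

theorem localMultiplicity_le_multiplicityCoeff (p : PrimeSpectrum R) :
    localMultiplicity R M p ≤ multiplicityCoeff R M (quotientDim R p : Ordinal) := by
  classical
  rw [multiplicityCoeff_apply (S := insert p (assPrimes R M)) (Finset.subset_insert _ _)]
  refine le_trans ?_ (Finset.single_le_sum (fun _ _ => Nat.zero_le _)
    (Finset.mem_insert_self p (assPrimes R M)))
  simp

theorem multiplicityCoeff_apply_congr {e : Ordinal}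
    (h : ∀ p : PrimeSpectrum R, (quotientDim R p : Ordinal) = e →
      localMultiplicity R M' p = localMultiplicity R M p) :
    multiplicityCoeff R M' e = multiplicityCoeff R M e := by
  classical
  rw [multiplicityCoeff_apply (M := M) (Finset.subset_union_left (s₂ := assPrimes R M')),
    multiplicityCoeff_apply (M := M') (Finset.subset_union_right (s₁ := assPrimes R M))]
  refine Finset.sum_congr rfl fun p _ => ?_
  split_ifs with hp
  · exact h p hp
  · rfl

theorem multiplicityCoeff_eq_of_lt (hR : ringKrullDim R < ⊤) {f : M →ₗ[R] M'}
    (hf : Function.Surjective f) {x : M} {p : PrimeSpectrum R}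
    (hx : ∀ a : R, a • x = 0 ↔ a ∈ p.asIdeal) (hle : LinearMap.ker f ≤ Submodule.span R {x})
    {e : Ordinal} (he : (quotientDim R p : Ordinal) < e) :
    multiplicityCoeff R M' e = multiplicityCoeff R M e := by
  refine multiplicityCoeff_apply_congr fun p' hp' =>
    localMultiplicity_eq_of_not_le hf hx hle fun hpp' => ?_
  rw [← hp', Nat.cast_lt] at he
  rcases hpp'.lt_or_eq with h | rfl
  · exact lt_asymm he (quotientDim_lt_of_lt hR h)
  · exact lt_irrefl _ he

theorem multiplicityCoeff_add_one (hR : ringKrullDim R < ⊤) {f : M →ₗ[R] M'}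
    (hf : Function.Surjective f) {x : M} {p : PrimeSpectrum R}
    (hx : ∀ a : R, a • x = 0 ↔ a ∈ p.asIdeal) (hle : LinearMap.ker f ≤ Submodule.span R {x})
    (hne : LinearMap.ker f ≠ ⊥) :
    multiplicityCoeff R M' (quotientDim R p : Ordinal) + 1 =
      multiplicityCoeff R M (quotientDim R p : Ordinal) := by
  classical
  have hp := localMultiplicity_eq_one_add hf hx hle hne
  set S := assPrimes R M ∪ assPrimes R M'
  have hpS : p ∈ S :=
    Finset.mem_union_left _ (mem_assPrimes_of_localMultiplicity_ne_zero (by lia))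
  rw [multiplicityCoeff_apply (M := M) (S := S) Finset.subset_union_left,
    multiplicityCoeff_apply (M := M') (S := S) Finset.subset_union_right,
    ← Finset.add_sum_erase S _ hpS, ← Finset.add_sum_erase S _ hpS, if_pos rfl, if_pos rfl, hp]
  have hrest : ∀ p' ∈ S.erase p,
      (if (quotientDim R p' : Ordinal.{v}) = quotientDim R p then
        localMultiplicity R M' p' else 0) =
      if (quotientDim R p' : Ordinal.{v}) = quotientDim R p then
        localMultiplicity R M p' else 0 := by
    intro p' hp'
    split_ifs with hd
    · refine localMultiplicity_eq_of_not_le hf hx hle fun hpp' => ?_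
      rw [Nat.cast_inj] at hd
      exact (quotientDim_lt_of_lt hR (hpp'.lt_of_ne (Finset.ne_of_mem_erase hp').symm)).ne hd
    · rfl
  rw [Finset.sum_congr rfl hrest]
  ring

/-- Dividing by a nonzero submodule of a copy of `R / p` lowers the coefficient at `dim R / p` and
leaves those at larger exponents unchanged. -/
theorem cohomologicalRank_lt_of_ker_le_span (hR : ringKrullDim R < ⊤) {f : M →ₗ[R] M'}
    (hf : Function.Surjective f) {x : M} {p : PrimeSpectrum R}
    (hx : ∀ a : R, a • x = 0 ↔ a ∈ p.asIdeal) (hle : LinearMap.ker f ≤ Submodule.span R {x})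
    (hne : LinearMap.ker f ≠ ⊥) : (cohomologicalRank R M' : Ordinal.{v}) < cohomologicalRank R M := by
  rw [cohomologicalRank_eq_ofCantorCoeff, cohomologicalRank_eq_ofCantorCoeff]
  refine ofCantorCoeff_lt (e := (quotientDim R p : Ordinal))
    (fun e he => multiplicityCoeff_eq_of_lt hR hf hx hle he) ?_
  have := multiplicityCoeff_add_one hR hf hx hle hne
  lia

theorem cohomologicalRank_congr {f : M →ₗ[R] M'} (hf : Function.Bijective f) :
    (cohomologicalRank R M' : Ordinal.{v}) = cohomologicalRank R M := by
  rw [cohomologicalRank_eq_ofCantorCoeff, cohomologicalRank_eq_ofCantorCoeff]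
  refine congrArg _ (Finsupp.ext fun e => multiplicityCoeff_apply_congr fun p _ => ?_)
  refine localMultiplicity_eq_of_ker_localized_eq_zero hf.2 fun z hz => ⟨1, ?_, ?_⟩
  · exact (Ideal.ne_top_iff_one _).1 p.isPrime.ne_top
  · rw [one_smul]
    exact (map_eq_zero_iff f hf.1).1 hz

/-- The values of the cohomological rank on the proper quotients of `M` are cofinal below its
value on `M`. -/
theorem exists_le_cohomologicalRank_of_lt (hR : ringKrullDim R < ⊤) {o : Ordinal.{v}}
    (ho : o < cohomologicalRank R M) : ∃ K : Submodule R M, K ≠ ⊥ ∧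
      ∀ (M' : Type v) [AddCommGroup M'] [Module R M'] [Module.Finite R M'] (f : M →ₗ[R] M'),
        Function.Surjective f → LinearMap.ker f = K → o ≤ cohomologicalRank R M' := by
  rw [cohomologicalRank_eq_ofCantorCoeff] at ho
  have hnonempty : ((assPrimes R M).filter (localMultiplicity R M · ≠ 0)).Nonempty := by
    by_contra hempty
    have hzero : multiplicityCoeff R M = 0 := Finset.sum_eq_zero fun p hp => by
      by_contra h
      exact hempty ⟨p, Finset.mem_filter.2 ⟨hp, fun h0 => h (by rw [h0, Finsupp.single_zero])⟩⟩
    rw [hzero, ofCantorCoeff] at ho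
    simp at ho
  obtain ⟨p, hp, hmin⟩ := Finset.exists_min_image _ (quotientDim R) hnonempty
  obtain ⟨hpAss, -⟩ := Finset.mem_filter.1 hp
  have hd : ∀ e < (quotientDim R p : Ordinal), multiplicityCoeff R M e = 0 := by
    intro e he
    rw [multiplicityCoeff_apply subset_rfl]
    refine Finset.sum_eq_zero fun p' hp' => ?_
    split_ifs with h
    · by_contra hne
      have := hmin p' (Finset.mem_filter.2 ⟨hp', hne⟩)
      rw [← h, Nat.cast_lt] at he
      lia
    · rfl
  obtain ⟨x, hx⟩ := exists_smul_eq_zero_iff_of_mem_associatedPrimes ((mem_assPrimes R M p).1 hpAss)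
  have hx0 : x ≠ 0 := fun h => p.isPrime.ne_top ((Ideal.eq_top_iff_one _).2 ((hx 1).1 (by simp [h])))
  -- In positive dimension `n + 1`, divide by `q ^ k x` with `dim R / q = n` and `k` larger than the
  -- coefficient of `o` at `n`; in dimension zero, divide by the simple module `R x`.
  obtain ⟨K, hKle, hKne, hK⟩ : ∃ K ≤ Submodule.span R {x}, K ≠ ⊥ ∧
      ∀ n : ℕ, n + 1 = quotientDim R p → ∃ q, p < q ∧ quotientDim R q = n ∧
        K = q.asIdeal ^ (cantorCoeff o n + 1) • Submodule.span R {x} := by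
    rcases hdim : quotientDim R p with _ | n
    · exact ⟨_, le_rfl, by simpa using hx0, by lia⟩
    · obtain ⟨q, hpq, hq⟩ := exists_lt_quotientDim_eq hR hdim.symm
      refine ⟨q.asIdeal ^ (cantorCoeff o n + 1) • Submodule.span R {x}, Submodule.smul_le_right,
        fun hbot => ?_, fun n' hn' => ⟨q, hpq, by lia, by rw [Nat.succ_injective hn']⟩⟩
      obtain ⟨t, htq, htp⟩ :=
        SetLike.not_le_iff_exists.1 (show ¬ q.asIdeal ≤ p.asIdeal from hpq.not_ge)
      have := (Submodule.eq_bot_iff _).1 hbot _ (Submodule.smul_mem_smul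
        (Ideal.pow_mem_pow htq _) (Submodule.mem_span_singleton_self x))
      exact htp (p.isPrime.mem_of_pow_mem _ ((hx _).1 this))
  refine ⟨K, hKne, fun M' _ _ _ f hf hker => ?_⟩
  rw [← ofCantorCoeff_cantorCoeff o] at ho
  rw [cohomologicalRank_eq_ofCantorCoeff, ← ofCantorCoeff_cantorCoeff o]
  refine le_ofCantorCoeff_of_lt ho hd
    (fun e he => multiplicityCoeff_eq_of_lt hR hf hx (hker ▸ hKle) he)
    (multiplicityCoeff_add_one hR hf hx (hker ▸ hKle) (hker ▸ hKne)) fun n hn => ?_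
  obtain ⟨q, hpq, rfl, hKq⟩ := hK n hn
  exact (Nat.lt_of_succ_le (le_localMultiplicity_of_ker_eq hx hpq (hker.trans hKq))).trans_le
    (localMultiplicity_le_multiplicityCoeff q)

end Coeff

/-! ### The rank function on submodules -/

section Rank

universe v

variable {R : Type*} {M : Type v} [CommRing R] [AddCommGroup M] [Module R M]

theorem exists_surjective_quotient_comap_mkQ (N : Submodule R M) (K : Submodule R (M ⧸ N)) :
    ∃ f : (M ⧸ N) →ₗ[R] (M ⧸ K.comap N.mkQ), Function.Surjective f ∧ LinearMap.ker f = K := by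
  have hle : N ≤ K.comap N.mkQ := fun z hz => by
    rw [Submodule.mem_comap, Submodule.mkQ_apply, (Submodule.Quotient.mk_eq_zero N).2 hz]
    exact K.zero_mem
  refine ⟨Submodule.factor hle, Submodule.factor_surjective hle, ?_⟩
  ext w
  obtain ⟨z, rfl⟩ := N.mkQ_surjective w
  rw [LinearMap.mem_ker, Submodule.factor_mk, Submodule.mkQ_apply, Submodule.Quotient.mk_eq_zero]
  rfl

theorem lt_comap_mkQ {N : Submodule R M} {K : Submodule R (M ⧸ N)} (hK : K ≠ ⊥) :
    N < K.comap N.mkQ := by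
  refine lt_of_le_of_ne ?_ fun h => hK ?_
  · conv_lhs => rw [← N.ker_mkQ]
    exact Submodule.comap_mono bot_le
  · rw [← Submodule.map_comap_eq_of_surjective N.mkQ_surjective K, ← h, Submodule.mkQ_map_self]

variable [IsNoetherianRing R] [Module.Finite R M]

/-- Between `N` and a larger submodule there is an `L` with `L / N` isomorphic to some `R / p`, and
passing from `N` to `L` lowers the cohomological rank of the quotient. -/
theorem cohomologicalRank_quotient_lt (hR : ringKrullDim R < ⊤) {N N' : Submodule R M}
    (h : N < N') :
    (cohomologicalRank R (M ⧸ N') : Ordinal.{v}) < cohomologicalRank R (M ⧸ N) := by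
  induction N using WellFoundedGT.induction with
  | _ N ih =>
    have hnt : Nontrivial (N'.map N.mkQ) := by
      rw [Submodule.nontrivial_iff_ne_bot, Ne, ← LinearMap.le_ker_iff_map, N.ker_mkQ]
      exact h.not_ge
    obtain ⟨P, hP⟩ := associatedPrimes.nonempty R (N'.map N.mkQ)
    obtain ⟨⟨x, hxN'⟩, hx⟩ := exists_smul_eq_zero_iff_of_mem_associatedPrimes hP
    have hx' : ∀ a : R, a • x = 0 ↔ a ∈ (⟨P, hP.1⟩ : PrimeSpectrum R).asIdeal := fun a => by
      rw [← hx a, ← Subtype.coe_inj]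
      rfl
    have hne : Submodule.span R {x} ≠ ⊥ := by
      rw [Ne, Submodule.span_singleton_eq_bot]
      intro h0
      exact hP.1.ne_top ((Ideal.eq_top_iff_one _).2 ((hx' 1).1 (by simp [h0])))
    obtain ⟨f, hf, hker⟩ := exists_surjective_quotient_comap_mkQ N (Submodule.span R {x})
    have hlt := cohomologicalRank_lt_of_ker_le_span hR hf hx' hker.le (hker.symm ▸ hne)
    have hNL := lt_comap_mkQ hne
    have hLN' : (Submodule.span R {x}).comap N.mkQ ≤ N' := by
      have h1 : Submodule.span R {x} ≤ N'.map N.mkQ :=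
        (Submodule.span_singleton_le_iff_mem _ _).2 hxN'
      refine (Submodule.comap_mono h1).trans ?_
      rw [Submodule.comap_map_mkQ, sup_eq_right.2 h.le]
    rcases hLN'.lt_or_eq with hL | hL
    · exact (ih _ hNL hL).trans hlt
    · rwa [← hL]

theorem rank_eq_cohomologicalRank_quotient (hR : ringKrullDim R < ⊤) (N : Submodule R M) :
    IsWellFounded.rank (fun N' N : Submodule R M => N < N') N = cohomologicalRank R (M ⧸ N) := by
  induction N using WellFoundedGT.induction with
  | _ N ih =>
    refine le_antisymm ?_ (le_of_not_gt fun hlt => ?_)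
    · rw [IsWellFounded.rank_eq]
      refine Ordinal.iSup_le fun ⟨N', hN'⟩ => Order.succ_le_of_lt ?_
      rw [ih N' hN']
      exact cohomologicalRank_quotient_lt hR hN'
    · obtain ⟨K, hK, hle⟩ := exists_le_cohomologicalRank_of_lt hR hlt
      obtain ⟨f, hf, hker⟩ := exists_surjective_quotient_comap_mkQ N K
      have h := hle _ f hf hker
      rw [← ih _ (lt_comap_mkQ hK)] at h
      exact h.not_gt (IsWellFounded.rank_lt_of_rel
        (r := fun N' N : Submodule R M => N < N') (lt_comap_mkQ hK))

end Rank

theorem theorem4p1 (R M : Type*) [CommRing R] [IsNoetherianRing R] (hR : ringKrullDim R < ⊤)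
    [AddCommGroup M] [Module R M] [Module.Finite R M] :
    ordinalLength R M = cohomologicalRank R M := by
  rw [ordinalLength, rank_eq_cohomologicalRank_quotient hR]
  refine cohomologicalRank_congr (f := (⊥ : Submodule R M).mkQ)
    ⟨LinearMap.ker_eq_bot.1 (Submodule.ker_mkQ _), Submodule.mkQ_surjective _⟩
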